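/- Let $p\ge 1$ and let $\Gamma\subset\mathbb{R}^p$ be a Jordan arc (a set homeomorphic to a closed segment) or a closed Jordan curve (a set homeomorphic to a circle), of finite length. Let $\mathcal H_1$ be one-dimensional Hausdorff measure, normalized so that a unit segment has measure $1$, and put $L=\mathcal H_1(\Gamma)$. Assume that $\Gamma$ is smooth: a natural (arclength) parametrization $\Phi:[0,L]\to\Gamma$ is of class $C^1$ on $[0,L]$ (one-sided derivatives at the endpoints) and $\Phi'(t)\neq 0$ for all $t\in[0,L]$. Let $k_1(x,y)=|x-y|^{-1}$ for $x\ne y$ and $k_1(x,x)=+\infty$. Let $(a_n)_{n\ge1}\subset\Gamma$ be any greedy $k_1$-energy sequence on $\Gamma$, that is, $a_1\in\Gamma$ is arbitrary and $$\sum_{i=1}^{n}k_1(a_{n+1},a_i)=\inf_{x\in\Gamma}\sum_{i=1}^{n}k_1(x,a_i)\qquad (n\ge 1).$$ Put $E_1(\alpha_N)=\sum_{1\le i\ne j\le N}k_1(a_i,a_j)$, the sum running over ordered pairs. Then $$\lim_{N\to\infty}\frac{E_1(\alpha_N)}{N^2\log N}=\frac{2}{\mathcal H_1(\Gamma)} .$$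 Furthermore, the normalized counting measures converge in the weak-star topology to normalized arclength on $\Gamma$: $$\frac1N\sum_{i=1}^{N}\delta_{a_i}\ \stackrel{*}{\longrightarrow}\ \frac{\mathcal H_1|_\Gamma}{\mathcal H_1(\Gamma)},\qquad N\to\infty,$$ that is, $\frac1N\sum_{i=1}^N f(a_i)\to\frac{1}{\mathcal H_1(\Gamma)}\int_\Gamma f\,d\mathcal H_1$ for every continuous $f:\Gamma\to\mathbb R$. -/

import Mathlib

open Set Filter Topology MeasureTheory
open scoped ENNReal

noncomputable section

/-- The Riesz kernel `k_s(x, y) = |x - y|^(-s)` for `s > 0`, with values in `[0, ∞]`;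
it equals `∞` on the diagonal. -/
def rieszKernel {X : Type*} [EDist X] (s : ℝ) (x y : X) : ℝ≥0∞ :=
  edist x y ^ (-s)

/-- Greedy `k`-energy sequence on `A`: the points lie in `A`, the first one is arbitrary, and every
later point minimizes over `A` the potential of the points chosen before it.
The sequence is indexed from `0`: `a n` is the `(n + 1)`-st point. -/
def IsGreedySequence {X : Type*} (k : X → X → ℝ≥0∞) (A : Set X) (a : ℕ → X) : Prop :=
  (∀ n, a n ∈ A) ∧
    ∀ n, 1 ≤ n →
      ∑ i ∈ Finset.range n, k (a n) (a i) = ⨅ x ∈ A, ∑ i ∈ Finset.range n, k x (a i)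

/-- Discrete energy of the first `N` points of the sequence `a`: the sum of `k (a i) (a j)` over
all ordered pairs of distinct indices. -/
def discreteEnergy {X : Type*} (k : X → X → ℝ≥0∞) (a : ℕ → X) (N : ℕ) : ℝ≥0∞ :=
  ∑ i ∈ Finset.range N, ∑ j ∈ (Finset.range N).erase i, k (a i) (a j)

/-- Normalized counting measure of the first `N` points of the sequence `a`. -/
def countingProb {X : Type*} [MeasurableSpace X] (a : ℕ → X) (N : ℕ) : Measure X :=
  (N : ℝ≥0∞)⁻¹ • ∑ i ∈ Finset.range N, Measure.dirac (a i)

/-- Weak-star convergence of finite measures carried by a compact set `A`: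
the integrals of every continuous function on `A` converge. -/
def WeakStarTendsto {X : Type*} [TopologicalSpace X] [MeasurableSpace X] (A : Set X)
    (ν : ℕ → Measure X) (μ : Measure X) : Prop :=
  ∀ f : X → ℝ, ContinuousOn f A →
    Tendsto (fun N => ∫ x in A, f x ∂(ν N)) atTop (𝓝 (∫ x in A, f x ∂μ))

/-- A Jordan arc: a set homeomorphic to a closed segment. -/
def IsJordanArc {X : Type*} [TopologicalSpace X] (Γ : Set X) : Prop :=
  Nonempty (Γ ≃ₜ Icc (0 : ℝ) 1)

/-- A closed Jordan curve: a set homeomorphic to a circle. -/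
def IsClosedJordanCurve {X : Type*} [TopologicalSpace X] (Γ : Set X) : Prop :=
  Nonempty (Γ ≃ₜ Circle)

/-- `Φ : [0, L] → Γ`, `L = H₁(Γ)`, is a surjective arclength parametrization of `Γ` which is of
class `C¹` on the closed interval (one-sided at the endpoints) with nowhere vanishing derivative.
Only the values of `Φ` on `[0, L]` matter. -/
structure IsSmoothNaturalParam {p : ℕ} (Γ : Set (EuclideanSpace ℝ (Fin p))) (L : ℝ)
    (Φ : ℝ → EuclideanSpace ℝ (Fin p)) : Prop where
  length_pos : 0 < L
  length_eq : μH[1] Γ = ENNReal.ofReal L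
  image_eq : Φ '' Icc 0 L = Γ
  unitSpeed : HasUnitSpeedOn Φ (Icc 0 L)
  contDiffOn : ContDiffOn ℝ 1 Φ (Icc 0 L)
  deriv_ne_zero : ∀ t ∈ Icc 0 L, derivWithin Φ (Icc 0 L) t ≠ 0

/-- Smooth Jordan arc: the natural parametrization (injective on `[0, L]`) is `C¹` with nonvanishing
derivative. -/
def IsSmoothJordanArc {p : ℕ} (Γ : Set (EuclideanSpace ℝ (Fin p))) : Prop :=
  IsJordanArc Γ ∧ ∃ L Φ, IsSmoothNaturalParam Γ L Φ ∧ InjOn Φ (Icc 0 L)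

/-- Smooth closed Jordan curve: a natural parametrization (closing up at `L`, and injective on
`[0, L)`) is `C¹` on `[0, L]` with nonvanishing derivative. The one-sided derivatives at `0` and `L`
are not required to agree, so the usual `C¹` closed curves are included, with any base point. -/
def IsSmoothClosedJordanCurve {p : ℕ} (Γ : Set (EuclideanSpace ℝ (Fin p))) : Prop :=
  IsClosedJordanCurve Γ ∧
    ∃ L Φ, IsSmoothNaturalParam Γ L Φ ∧ Φ 0 = Φ L ∧ InjOn Φ (Ico 0 L)

end

/-! The energy is squeezed between matching multiples of `N² log N`, and equidistribution follows
from near-equality in the lower bound.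

Lower bound (`sum_inv_sub_ge`, `energy_subset_ge`): chords are no longer than arcs, so points on an
arc of length `ℓ` have at least the energy of their parameters on an interval of length `ℓ`. For `m`
sorted points the gaps of index difference `k` sum to at most `kℓ`; convexity of `1/y` and summation
over `k` give about `2 m² log m / ℓ`.

Upper bound (`exists_potential_le`): a greedy point has potential at most any average of the
potential. The average is taken away from the endpoints and from radius `r/n` around the earlier
parameters; there the kernel is almost `|t - s|⁻¹`, whose integral is `2 log n + O(1)`. Summing over
`n < N` and letting `ε → 0` gives `2/L`.

Equidistribution (`tendsto_proportion_of_energy`): cut at arclength `c`, with a proportion `x` of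
the points in the first arc. The lower bound on both arcs has leading coefficient `2 (x²/c +
(1-x)²/(L-c))`, which exceeds `2/L` by a multiple of `(x - c/L)²`. Hence `x → c/L`. -/

/-! ### Lower energy bound on an interval -/

/-- Summing over the off-diagonal pairs of a symmetric array doubles the sum below the diagonal. -/
theorem sum_range_erase_eq_two_mul {F : ℕ → ℕ → ℝ≥0∞} (hF : ∀ i j, F i j = F j i) (N : ℕ) :
    ∑ i ∈ Finset.range N, ∑ j ∈ (Finset.range N).erase i, F i j =
      2 * ∑ i ∈ Finset.range N, ∑ j ∈ Finset.range i, F i j := by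
  induction N with
  | zero => simp
  | succ N ih =>
    rw [Finset.sum_range_succ, Finset.sum_range_succ, mul_add, ← ih]
    have h1 : (Finset.range (N + 1)).erase N = Finset.range N := by
      ext j; simp only [Finset.mem_erase, Finset.mem_range]; omega
    have h2 : ∀ i ∈ Finset.range N, ∑ j ∈ (Finset.range (N + 1)).erase i, F i j =
        ∑ j ∈ (Finset.range N).erase i, F i j + F N i := by
      intro i hi
      have : (Finset.range (N + 1)).erase i = insert N ((Finset.range N).erase i) := by
        ext j
        simp only [Finset.mem_erase, Finset.mem_range, Finset.mem_insert] at hi ⊢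
        omega
      rw [this, Finset.sum_insert (by simp), add_comm, hF i N]
    rw [h1, Finset.sum_congr rfl h2, Finset.sum_add_distrib]
    ring

/-- The sum telescopes to the `k` differences `x (n + i) - x i`, each at most `ℓ`. -/
theorem sum_shift_sub_le {x : ℕ → ℝ} {ℓ : ℝ} {n k : ℕ}
    (h : ∀ i < n + k, ∀ j < n + k, x i - x j ≤ ℓ) :
    ∑ i ∈ Finset.range n, (x (i + k) - x i) ≤ k * ℓ := by
  have h1 := Finset.sum_range_add x n k
  have h2 := Finset.sum_range_add x k n
  have h3 : ∑ i ∈ Finset.range n, (x (i + k) - x i) =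
      ∑ i ∈ Finset.range k, (x (n + i) - x i) := by
    simp only [Finset.sum_sub_distrib]
    rw [add_comm k n] at h2
    simp only [add_comm k] at h2
    linarith
  rw [h3]
  calc ∑ i ∈ Finset.range k, (x (n + i) - x i) ≤ ∑ i ∈ Finset.range k, ℓ := by
        refine Finset.sum_le_sum fun i hi => h _ ?_ _ ?_ <;>
          have := Finset.mem_range.1 hi <;> omega
    _ = k * ℓ := by simp

/-- For `c > 0` the left side is the tangent line of the convex function `y⁻¹` at `1 / c`. -/
theorem two_mul_sub_sq_mul_le_inv {y : ℝ} (hy : 0 < y) (c : ℝ) : 2 * c - c ^ 2 * y ≤ y⁻¹ := by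
  have : y⁻¹ - (2 * c - c ^ 2 * y) = (1 - c * y) ^ 2 * y⁻¹ := by field_simp; ring
  have h2 : 0 ≤ (1 - c * y) ^ 2 * y⁻¹ := by positivity
  linarith

/-- Lower bound for the sum of the reciprocal gaps of `m` increasing points in an interval of
length `ℓ`. -/
theorem sum_inv_sub_ge {x : ℕ → ℝ} {ℓ : ℝ} (hℓ : 0 < ℓ) {m : ℕ}
    (hx : ∀ j < m, ∀ i < j, x i < x j) (h : ∀ i < m, ∀ j < m, x i - x j ≤ ℓ) :
    ((m : ℝ) ^ 2 * Real.log m - 2 * (m : ℝ) ^ 2) / ℓ ≤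
      ∑ i ∈ Finset.range m, ∑ j ∈ Finset.range i, (x i - x j)⁻¹ := by
  obtain _ | m := m
  · simp
  have e1 : ∑ i ∈ Finset.range (m + 1), ∑ j ∈ Finset.range i, (x i - x j)⁻¹ =
      ∑ d ∈ Finset.range m, ∑ j ∈ Finset.range (m - d), (x (j + (d + 1)) - x j)⁻¹ := by
    rw [Finset.sum_range_succ', Finset.sum_range_zero, add_zero]
    rw [← Finset.sum_range_diag_flip m (fun d j => (x (j + (d + 1)) - x j)⁻¹)]
    refine Finset.sum_congr rfl fun i _ => ?_
    rw [← Finset.sum_range_reflect]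
    refine Finset.sum_congr rfl fun d hd => ?_
    have := Finset.mem_range.1 hd
    rw [show i + 1 - 1 - d = i - d by omega, show i - d + (d + 1) = i + 1 by omega]
  have e2 : ∀ d ∈ Finset.range m, ((m : ℝ) + 1) ^ 2 / ℓ * ((d : ℝ) + 1)⁻¹ - 2 * (m + 1) / ℓ ≤
      ∑ j ∈ Finset.range (m - d), (x (j + (d + 1)) - x j)⁻¹ := by
    intro d hd
    have hd' := Finset.mem_range.1 hd
    -- The tangent point `1 / c` is the gap across `d + 1` steps of length `ℓ / (m + 1)`, as if the
    -- `m + 1` points were evenly spread.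
    set c : ℝ := (m + 1) / ((d + 1) * ℓ) with hc
    have hgap := sum_shift_sub_le (x := x) (ℓ := ℓ) (n := m - d) (k := d + 1)
      (fun i hi j hj => h i (by omega) j (by omega))
    have hcast : ((m - d : ℕ) : ℝ) = m - d := by rw [Nat.cast_sub hd'.le]
    calc ((m : ℝ) + 1) ^ 2 / ℓ * ((d : ℝ) + 1)⁻¹ - 2 * (m + 1) / ℓ
        = 2 * c * (m - d : ℕ) - c ^ 2 * ((d + 1 : ℕ) * ℓ) := by
          rw [hcast, hc]; push_cast; field_simp; ring
      _ ≤ 2 * c * (m - d : ℕ) -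
            c ^ 2 * ∑ j ∈ Finset.range (m - d), (x (j + (d + 1)) - x j) := by gcongr
      _ = ∑ j ∈ Finset.range (m - d), (2 * c - c ^ 2 * (x (j + (d + 1)) - x j)) := by
          rw [Finset.mul_sum, Finset.sum_sub_distrib]; simp [mul_comm]
      _ ≤ _ := by
          refine Finset.sum_le_sum fun j hj => two_mul_sub_sq_mul_le_inv ?_ c
          have := Finset.mem_range.1 hj
          exact sub_pos.2 (hx _ (by omega) _ (by omega))
  rw [e1]
  refine le_trans ?_ (Finset.sum_le_sum e2)
  have hlog := log_add_one_le_harmonic m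
  have hH : ((harmonic m : ℚ) : ℝ) = ∑ d ∈ Finset.range m, ((d : ℝ) + 1)⁻¹ := by
    simp [harmonic]
  rw [hH] at hlog
  rw [Finset.sum_sub_distrib, ← Finset.mul_sum, Finset.sum_const, Finset.card_range, nsmul_eq_mul]
  push_cast at hlog ⊢
  have h3 : ((m : ℝ) + 1) ^ 2 / ℓ * Real.log (m + 1) ≤
      ((m : ℝ) + 1) ^ 2 / ℓ * ∑ d ∈ Finset.range m, ((d : ℝ) + 1)⁻¹ := by gcongr
  have h4 : (m : ℝ) * (2 * (m + 1) / ℓ) ≤ 2 * ((m : ℝ) + 1) ^ 2 / ℓ := by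
    rw [← mul_div_assoc]
    exact div_le_div_of_nonneg_right (by nlinarith [(Nat.cast_nonneg m : (0 : ℝ) ≤ m)]) hℓ.le
  have h5 : (((m : ℝ) + 1) ^ 2 * Real.log (m + 1) - 2 * ((m : ℝ) + 1) ^ 2) / ℓ =
      ((m : ℝ) + 1) ^ 2 / ℓ * Real.log (m + 1) - 2 * ((m : ℝ) + 1) ^ 2 / ℓ := by ring
  linarith

/-- Any `S.card` points of an interval of length `ℓ` have energy at least
`2 (m² log m - 2 m²) / ℓ`, where `m = S.card`. -/
theorem energy_interval_ge {S : Finset ℕ} {t : ℕ → ℝ} {b ℓ : ℝ} (hℓ : 0 < ℓ)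
    (ht : ∀ i ∈ S, t i ∈ Icc b (b + ℓ)) :
    ENNReal.ofReal (2 * (((S.card : ℝ) ^ 2 * Real.log S.card - 2 * (S.card : ℝ) ^ 2) / ℓ)) ≤
      ∑ i ∈ S, ∑ j ∈ S.erase i, (edist (t i) (t j))⁻¹ := by
  -- A repeated point makes the right side infinite; distinct points can be sorted.
  by_cases hinj : InjOn t S
  swap
  · simp only [InjOn, not_forall] at hinj
    obtain ⟨i, hi, j, hj, hij, hne⟩ := hinj
    refine le_trans le_top (le_of_eq ?_)
    symm
    rw [ENNReal.sum_eq_top]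
    refine ⟨i, hi, ?_⟩
    rw [ENNReal.sum_eq_top]
    exact ⟨j, Finset.mem_erase.2 ⟨Ne.symm hne, hj⟩, by simp [hij]⟩
  set T := S.image t with hT
  have hcard : T.card = S.card := Finset.card_image_of_injOn hinj
  -- Increasing enumeration of the points; the value `0` beyond `T.card` is never used.
  let x : ℕ → ℝ := fun i => if h : i < T.card then T.orderEmbOfFin rfl ⟨i, h⟩ else 0
  have hxT : ∀ i < T.card, x i ∈ T := fun i hi => by
    simp only [x, hi, dif_pos]; exact Finset.orderEmbOfFin_mem _ _ _
  have hxmono : ∀ j < T.card, ∀ i < j, x i < x j := fun j hj i hij => by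
    simp only [x, hj, hij.trans hj, dif_pos]
    exact (T.orderEmbOfFin rfl).strictMono hij
  have hxinj : InjOn x (Finset.range T.card) := by
    intro i hi j hj hij
    simp only [Finset.coe_range, mem_Iio] at hi hj
    by_contra hne
    rcases lt_or_gt_of_ne hne with h | h
    · exact (hxmono j hj i h).ne hij
    · exact (hxmono i hi j h).ne' hij
  have hximage : (Finset.range T.card).image x = T := by
    refine Finset.eq_of_subset_of_card_le ?_ ?_
    · intro y hy
      obtain ⟨i, hi, rfl⟩ := Finset.mem_image.1 hy
      exact hxT i (Finset.mem_range.1 hi)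
    · rw [Finset.card_image_of_injOn hxinj, Finset.card_range]
  have transfer : ∀ (A : Finset ℕ) (f : ℕ → ℝ), InjOn f A →
      ∑ i ∈ A, ∑ j ∈ A.erase i, (edist (f i) (f j))⁻¹ =
        ∑ u ∈ A.image f, ∑ v ∈ (A.image f).erase u, (edist u v)⁻¹ := by
    intro A f hf
    rw [Finset.sum_image hf]
    refine Finset.sum_congr rfl fun i hi => ?_
    have : (A.image f).erase (f i) = (A.erase i).image f := by
      ext y
      simp only [Finset.mem_erase, Finset.mem_image]
      constructor
      · rintro ⟨hy, j, hj, rfl⟩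
        exact ⟨j, ⟨fun h => hy (by rw [h]), hj⟩, rfl⟩
      · rintro ⟨j, ⟨hj, hjA⟩, rfl⟩
        exact ⟨fun h => hj (hf hjA hi h), j, hjA, rfl⟩
    rw [this, Finset.sum_image]
    exact hf.mono (Finset.coe_subset.2 (Finset.erase_subset _ _))
  have hTb : ∀ y ∈ T, y ∈ Icc b (b + ℓ) := by
    intro y hy
    obtain ⟨i, hi, rfl⟩ := Finset.mem_image.1 hy
    exact ht i hi
  rw [transfer S t hinj, ← hT, ← hximage, ← transfer _ x hxinj,
    sum_range_erase_eq_two_mul (fun i j => by rw [edist_comm]), ← hcard]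
  have hmain := sum_inv_sub_ge hℓ hxmono (fun i hi j hj => by
    have h1 := hTb _ (hxT i hi); have h2 := hTb _ (hxT j hj)
    linarith [h1.2, h2.1])
  have hsum : ∑ i ∈ Finset.range T.card, ∑ j ∈ Finset.range i, (edist (x i) (x j))⁻¹ =
      ENNReal.ofReal (∑ i ∈ Finset.range T.card, ∑ j ∈ Finset.range i, (x i - x j)⁻¹) := by
    have hpos : ∀ i ∈ Finset.range T.card, ∀ j ∈ Finset.range i, 0 < x i - x j :=
      fun i hi j hj => sub_pos.2 (hxmono i (Finset.mem_range.1 hi) j (Finset.mem_range.1 hj))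
    rw [ENNReal.ofReal_sum_of_nonneg fun i hi => Finset.sum_nonneg fun j hj =>
      (inv_pos.2 (hpos i hi j hj)).le]
    refine Finset.sum_congr rfl fun i hi => ?_
    rw [ENNReal.ofReal_sum_of_nonneg fun j hj => (inv_pos.2 (hpos i hi j hj)).le]
    refine Finset.sum_congr rfl fun j hj => ?_
    rw [edist_dist, Real.dist_eq, abs_of_pos (hpos i hi j hj),
      ENNReal.ofReal_inv_of_pos (hpos i hi j hj)]
  rw [hsum, ENNReal.ofReal_mul (by norm_num), ENNReal.ofReal_ofNat]
  gcongr

/-! ### Chords and arcs -/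

/-- A positive continuous function on a compact set of parameter pairs is bounded below. Keeping `t`
away from the ends allows a closed curve, where `Φ 0 = Φ L`. -/
theorem exists_dist_ge_of_injective {X : Type*} [MetricSpace X] {Φ : ℝ → X} {L : ℝ}
    (hc : ContinuousOn Φ (Icc 0 L))
    (hinj : ∀ t ∈ Ioo 0 L, ∀ s ∈ Icc 0 L, Φ s = Φ t → s = t) {η δ : ℝ} (hη : 0 < η)
    (hδ : 0 < δ) :
    ∃ c > 0, ∀ t ∈ Icc η (L - η), ∀ s ∈ Icc 0 L, δ ≤ |s - t| → c ≤ dist (Φ s) (Φ t) := by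
  have hsub : Icc η (L - η) ⊆ Icc 0 L := Icc_subset_Icc hη.le (by linarith)
  have hK : IsCompact ((Icc 0 L ×ˢ Icc η (L - η)) ∩ {q : ℝ × ℝ | δ ≤ |q.1 - q.2|}) :=
    (isCompact_Icc.prod isCompact_Icc).inter_right
      (isClosed_le continuous_const (by fun_prop))
  have hcont : ContinuousOn (fun q : ℝ × ℝ => dist (Φ q.1) (Φ q.2))
      ((Icc 0 L ×ˢ Icc η (L - η)) ∩ {q : ℝ × ℝ | δ ≤ |q.1 - q.2|}) := by
    exact continuous_dist.comp_continuousOn ((hc.comp continuousOn_fst fun q hq => hq.1.1).prodMk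
      (hc.comp continuousOn_snd fun q hq => hsub hq.1.2))
  obtain ⟨c, hc0, H⟩ := hK.exists_forall_le' hcont (a := 0) (by
    rintro ⟨s, t⟩ ⟨⟨hs, ht⟩, hst⟩
    refine dist_pos.2 fun h => ?_
    have : s = t := hinj t ⟨by linarith [ht.1], by linarith [ht.2]⟩ s hs h
    simp only [mem_ofPred_eq, this, sub_self, abs_zero] at hst
    linarith)
  exact ⟨c, hc0, fun t ht s hs hst => H (s, t) ⟨⟨hs, ht⟩, hst⟩⟩

theorem HasUnitSpeedOn.edist_le {F : Type*} [PseudoEMetricSpace F] {f : ℝ → F} {S : Set ℝ}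
    (h : HasUnitSpeedOn f S) {s t : ℝ} (hs : s ∈ S) (ht : t ∈ S) :
    edist (f s) (f t) ≤ edist s t := by
  wlog hst : s ≤ t generalizing s t
  · rw [edist_comm, edist_comm s]; exact this ht hs (le_of_not_ge hst)
  have h1 := hasConstantSpeedOnWith_iff_ordered.1 h hs ht hst
  calc edist (f s) (f t) ≤ eVariationOn f (S ∩ Icc s t) :=
        eVariationOn.edist_le f ⟨hs, left_mem_Icc.2 hst⟩ ⟨ht, right_mem_Icc.2 hst⟩
    _ = edist s t := by
        rw [h1, edist_comm, edist_dist, Real.dist_eq, abs_of_nonneg (sub_nonneg.2 hst)]; simp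

section Chord

variable {E : Type*} [NormedAddCommGroup E] [NormedSpace ℝ E] {Φ : ℝ → E} {L : ℝ}

/-- On short arcs of a `C¹` curve of unit speed, chords are almost as long as arcs. -/
theorem exists_chord_ge (hu : HasUnitSpeedOn Φ (Icc 0 L)) (hC : ContDiffOn ℝ 1 Φ (Icc 0 L))
    (hL : 0 < L) {ε : ℝ} (hε : 0 < ε) :
    ∃ δ > 0, ∀ s ∈ Icc 0 L, ∀ t ∈ Icc 0 L, |s - t| < δ →
      (1 - ε) * |s - t| ≤ dist (Φ s) (Φ t) := by
  have hud : UniqueDiffOn ℝ (Icc 0 L) := uniqueDiffOn_Icc hL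
  have hcont := hC.continuousOn_derivWithin hud le_rfl
  have hunif := isCompact_Icc.uniformContinuousOn_of_continuous hcont
  obtain ⟨δ, hδ, H⟩ := Metric.uniformContinuousOn_iff.1 hunif (ε / 2) (by positivity)
  refine ⟨δ, hδ, fun s hs t ht hst => ?_⟩
  wlog hle : s ≤ t generalizing s t
  · rw [dist_comm, abs_sub_comm]
    exact this t ht s hs (by rwa [abs_sub_comm]) (le_of_not_ge hle)
  rw [abs_sub_comm, abs_of_nonneg (sub_nonneg.2 hle)] at hst ⊢
  -- On `[s, t]` the curve differs from motion with velocity `v` by a map with Lipschitz constant `ε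
  -- / 2`.
  set v := derivWithin Φ (Icc 0 L) s with hv
  have hsub : Icc s t ⊆ Icc 0 L := Icc_subset_Icc hs.1 ht.2
  have key : ∀ u ∈ Icc s t, ∀ w ∈ Icc s t, ‖(Φ w - w • v) - (Φ u - u • v)‖ ≤ ε / 2 * ‖w - u‖ := by
    intro u hu' w hw
    refine Convex.norm_image_sub_le_of_norm_hasDerivWithin_le
      (f := fun u => Φ u - u • v) (f' := fun u => derivWithin Φ (Icc 0 L) u - v)
      (s := Icc s t) (fun x hx => ?_) (fun x hx => ?_) (convex_Icc s t) hu' hw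
    · have h1 : HasDerivWithinAt Φ (derivWithin Φ (Icc 0 L) x) (Icc s t) x :=
        (((hC.differentiableOn one_ne_zero) x (hsub hx)).hasDerivWithinAt).mono hsub
      have h2 : HasDerivWithinAt (fun u : ℝ => u • v) ((1 : ℝ) • v) (Icc s t) x :=
        (hasDerivWithinAt_id x _).smul_const v
      rw [one_smul] at h2
      exact h1.sub h2
    · have := H x (hsub hx) s hs (by
        rw [Real.dist_eq, abs_of_nonneg (sub_nonneg.2 hx.1)]; linarith [hx.2])
      rw [dist_eq_norm] at this
      exact this.le
  have hvar : eVariationOn Φ (Icc s t) = ENNReal.ofReal (t - s) := by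
    have := hasConstantSpeedOnWith_iff_ordered.1 hu hs ht hle
    rw [inter_eq_self_of_subset_right hsub] at this
    simpa using this
  have hlip : LipschitzOnWith (Real.toNNReal (‖v‖ + ε / 2)) Φ (Icc s t) := by
    refine LipschitzOnWith.of_dist_le_mul fun w hw u hu' => ?_
    rw [Real.coe_toNNReal _ (by positivity), dist_eq_norm, dist_eq_norm]
    have h1 := key u hu' w hw
    have h2 : Φ w - Φ u = ((Φ w - w • v) - (Φ u - u • v)) + (w - u) • v := by
      rw [sub_smul]; abel
    calc ‖Φ w - Φ u‖ ≤ ‖(Φ w - w • v) - (Φ u - u • v)‖ + ‖(w - u) • v‖ := by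
          rw [h2]; exact norm_add_le _ _
      _ ≤ ε / 2 * ‖w - u‖ + ‖w - u‖ * ‖v‖ := by rw [norm_smul]; gcongr
      _ = _ := by ring
  -- Comparing the length `t - s` of the arc with the Lipschitz constant bounds `‖v‖` below by `1 -
  -- ε / 2` when `s < t`.
  have hvle : ENNReal.ofReal (t - s) ≤ ENNReal.ofReal ((‖v‖ + ε / 2) * (t - s)) := by
    rw [← hvar, ENNReal.ofReal_mul (by positivity)]
    calc eVariationOn Φ (Icc s t) = eVariationOn (Φ ∘ id) (Icc s t) := rfl
      _ ≤ ENNReal.ofReal (‖v‖ + ε / 2) * eVariationOn id (Icc s t) :=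
          hlip.comp_eVariationOn_le (mapsTo_id _)
      _ ≤ _ := by
          gcongr
          have := (monotoneOn_id (α := ℝ) (s := Icc s t)).eVariationOn_eq
            (left_mem_Icc.2 hle) (right_mem_Icc.2 hle)
          rw [inter_self] at this
          exact this.le
  have hvle' : t - s ≤ (‖v‖ + ε / 2) * (t - s) :=
    (ENNReal.ofReal_le_ofReal_iff (mul_nonneg (by positivity) (sub_nonneg.2 hle))).1 hvle
  have h1 := key s (left_mem_Icc.2 hle) t (right_mem_Icc.2 hle)
  have h2 : (t - s) • v = (Φ t - Φ s) - ((Φ t - t • v) - (Φ s - s • v)) := by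
    rw [sub_smul]; abel
  have h3 : ‖(t - s) • v‖ ≤ ‖Φ t - Φ s‖ + ‖(Φ t - t • v) - (Φ s - s • v)‖ := by
    rw [h2]; exact norm_sub_le _ _
  rw [norm_smul, Real.norm_eq_abs, abs_of_nonneg (sub_nonneg.2 hle)] at h3
  rw [Real.norm_eq_abs, abs_of_nonneg (sub_nonneg.2 hle)] at h1
  rw [dist_comm, dist_eq_norm]
  nlinarith

/-- Away from the endpoints, the kernel `|x - y|⁻¹` on a `C¹` curve is bounded by a multiple close
to `1` of the kernel in the parameters, up to an additive constant. -/
theorem exists_inv_edist_le (hu : HasUnitSpeedOn Φ (Icc 0 L)) (hC : ContDiffOn ℝ 1 Φ (Icc 0 L))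
    (hL : 0 < L) (hinj : ∀ t ∈ Ioo 0 L, ∀ s ∈ Icc 0 L, Φ s = Φ t → s = t)
    {ε η : ℝ} (hε : 0 < ε) (hε1 : ε < 1) (hη : 0 < η) :
    ∃ C ≥ 0, ∀ t ∈ Icc η (L - η), ∀ s ∈ Icc 0 L, s ≠ t →
      (edist (Φ t) (Φ s))⁻¹ ≤ ENNReal.ofReal (C + (1 - ε)⁻¹ * |t - s|⁻¹) := by
  obtain ⟨δ, hδ, h1⟩ := exists_chord_ge hu hC hL hε
  obtain ⟨c, hc, h2⟩ := exists_dist_ge_of_injective hC.continuousOn hinj hη hδ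
  refine ⟨c⁻¹, by positivity, fun t ht s hs hst => ?_⟩
  have ht' : t ∈ Icc 0 L := ⟨by linarith [ht.1], by linarith [ht.2]⟩
  have hpos : 0 < |t - s| := abs_pos.2 (sub_ne_zero.2 hst.symm)
  have hε' : 0 < 1 - ε := by linarith
  rw [edist_dist]
  by_cases hd : |s - t| < δ
  · have h := h1 s hs t ht' hd
    rw [dist_comm, abs_sub_comm] at h
    have : 0 < (1 - ε) * |t - s| := by positivity
    rw [← ENNReal.ofReal_inv_of_pos (this.trans_le h)]
    refine ENNReal.ofReal_le_ofReal ?_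
    calc (dist (Φ t) (Φ s))⁻¹ ≤ ((1 - ε) * |t - s|)⁻¹ := by gcongr
      _ ≤ _ := by rw [mul_inv]; linarith [inv_pos.2 hc]
  · have h := h2 t ht s hs (not_lt.1 hd)
    rw [dist_comm] at h
    rw [← ENNReal.ofReal_inv_of_pos (hc.trans_le h)]
    refine ENNReal.ofReal_le_ofReal ?_
    calc (dist (Φ t) (Φ s))⁻¹ ≤ c⁻¹ := by gcongr
      _ ≤ _ := by
        have : 0 ≤ (1 - ε)⁻¹ * |t - s|⁻¹ := by positivity
        linarith

end Chord

/-! ### Points of small potential and the upper energy bound -/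

/-- Each side of `s` contributes at most `∫ du/u` over `[ρ, L]`. The two sides are the source of the
`2` in the limit `2 / L`. -/
theorem setLIntegral_inv_abs_sub_le {L ρ s : ℝ} (hρ : 0 < ρ) (hρL : ρ ≤ L) (hs : s ∈ Icc 0 L) :
    ∫⁻ t in Icc 0 L \ Metric.ball s ρ, ENNReal.ofReal |t - s|⁻¹ ≤
      ENNReal.ofReal (2 * Real.log (L / ρ)) := by
  have hlog : 0 ≤ Real.log (L / ρ) := Real.log_nonneg ((one_le_div hρ).2 hρL)
  have base : ∫⁻ u in Icc ρ L, ENNReal.ofReal u⁻¹ = ENNReal.ofReal (Real.log (L / ρ)) := by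
    have hint : IntegrableOn (fun u : ℝ => u⁻¹) (Icc ρ L) :=
      (continuousOn_id.inv₀ fun u hu => (hρ.trans_le hu.1).ne').integrableOn_Icc
    rw [← ofReal_integral_eq_lintegral_ofReal hint, integral_Icc_eq_integral_Ioc,
      ← intervalIntegral.integral_of_le hρL, integral_inv_of_pos hρ (hρ.trans_le hρL)]
    filter_upwards [ae_restrict_mem measurableSet_Icc] with u hu
    exact inv_nonneg.2 (hρ.le.trans hu.1)
  have right : ∫⁻ t in (fun t => t - s) ⁻¹' Icc ρ L, ENNReal.ofReal |t - s|⁻¹ =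
      ENNReal.ofReal (Real.log (L / ρ)) := by
    rw [← base, (measurePreserving_sub_right volume s).setLIntegral_comp_preimage
      measurableSet_Icc (f := fun u => ENNReal.ofReal |u|⁻¹) (by fun_prop)]
    refine setLIntegral_congr_fun measurableSet_Icc fun u hu => ?_
    simp only [abs_of_pos (hρ.trans_le hu.1)]
  have left : ∫⁻ t in (fun t => s - t) ⁻¹' Icc ρ L, ENNReal.ofReal |t - s|⁻¹ =
      ENNReal.ofReal (Real.log (L / ρ)) := by
    simp only [abs_sub_comm _ s]
    rw [← base, (Measure.measurePreserving_sub_left volume s).setLIntegral_comp_preimage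
      measurableSet_Icc (f := fun u => ENNReal.ofReal |u|⁻¹) (by fun_prop)]
    refine setLIntegral_congr_fun measurableSet_Icc fun u hu => ?_
    simp only [abs_of_pos (hρ.trans_le hu.1)]
  have hsub : Icc 0 L \ Metric.ball s ρ ⊆
      ((fun t => t - s) ⁻¹' Icc ρ L) ∪ ((fun t => s - t) ⁻¹' Icc ρ L) := by
    rintro t ⟨ht, htb⟩
    rw [Metric.mem_ball, Real.dist_eq, not_lt] at htb
    rcases le_total s t with h | h
    · left
      rw [abs_of_nonneg (sub_nonneg.2 h)] at htb
      exact ⟨htb, by linarith [ht.2, hs.1]⟩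
    · right
      rw [abs_of_nonpos (sub_nonpos.2 h)] at htb
      exact ⟨by linarith, by linarith [ht.1, hs.2]⟩
  calc _ ≤ _ := lintegral_mono_set hsub
    _ ≤ _ := lintegral_union_le _ _ _
    _ = _ := by rw [left, right, ← ENNReal.ofReal_add hlog hlog]; ring_nf

section Potential

variable {E : Type*} [NormedAddCommGroup E] [NormedSpace ℝ E] {Φ : ℝ → E} {L : ℝ}

/-- Averaging over the curve away from the endpoints and from the given points yields a point of
small potential. -/
theorem exists_potential_le (hu : HasUnitSpeedOn Φ (Icc 0 L)) (hC : ContDiffOn ℝ 1 Φ (Icc 0 L))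
    (hinj : ∀ t ∈ Ioo 0 L, ∀ s ∈ Icc 0 L, Φ s = Φ t → s = t)
    {ε : ℝ} (hε : 0 < ε) (hε1 : ε < 1) (hεL : ε < L) :
    ∃ C ≥ 0, ∀ n : ℕ, 1 ≤ n → ∀ s : ℕ → ℝ, (∀ i, s i ∈ Icc 0 L) → ∃ t ∈ Icc 0 L,
      ∑ i ∈ Finset.range n, (edist (Φ t) (Φ (s i)))⁻¹ ≤
        ENNReal.ofReal (n * (2 / ((1 - ε) * (L - ε)) * Real.log n + C)) := by
  have hL : 0 < L := hε.trans hεL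
  have hε' : 0 < 1 - ε := by linarith
  have hεL' : 0 < L - ε := by linarith
  -- Length `r` is removed at each end and at most `2r` by the balls, in all `4r = ε`.
  set r := ε / 4 with hr
  have hr0 : 0 < r := by positivity
  have hrL : r ≤ L := by linarith
  obtain ⟨C₀, hC₀, hker⟩ := exists_inv_edist_le hu hC hL hinj hε hε1 hr0
  have hlogr : 0 ≤ Real.log (L / r) := Real.log_nonneg ((one_le_div hr0).2 hrL)
  refine ⟨(C₀ * L + (1 - ε)⁻¹ * (2 * Real.log (L / r))) / (L - ε), by positivity,
    fun n hn s hs => ?_⟩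
  have hn0 : (0 : ℝ) < n := by exact_mod_cast hn
  have hn1 : (1 : ℝ) ≤ n := by exact_mod_cast hn
  -- The `n` balls have total length at most `2r`, and `log (L / ρ) = log n + log (L / r)`.
  set ρ := r / n with hρ
  have hρ0 : 0 < ρ := by positivity
  have hρL : ρ ≤ L := (div_le_self hr0.le hn1).trans hrL
  have hlog : 0 ≤ Real.log (L / ρ) := Real.log_nonneg ((one_le_div hρ0).2 hρL)
  set D := Icc r (L - r) \ ⋃ i ∈ Finset.range n, Metric.ball (s i) ρ with hD
  have hDI : D ⊆ Icc 0 L :=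
    sdiff_subset.trans (Icc_subset_Icc hr0.le (by linarith))
  have hDm : MeasurableSet D := measurableSet_Icc.diff
    (Finset.measurableSet_biUnion _ fun i _ => Metric.isOpen_ball.measurableSet)
  have hvol : ENNReal.ofReal (L - ε) ≤ volume D := by
    have h1 : volume (⋃ i ∈ Finset.range n, Metric.ball (s i) ρ) ≤ ENNReal.ofReal (2 * r) := by
      refine (measure_biUnion_finset_le _ _).trans ?_
      simp only [Real.volume_ball, Finset.sum_const, Finset.card_range, nsmul_eq_mul]
      rw [← ENNReal.ofReal_natCast, ← ENNReal.ofReal_mul (by positivity)]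
      exact ENNReal.ofReal_le_ofReal (by rw [hρ]; field_simp; rfl)
    calc ENNReal.ofReal (L - ε) = ENNReal.ofReal (L - r - r) - ENNReal.ofReal (2 * r) := by
          rw [← ENNReal.ofReal_sub _ (by positivity)]; congr 1; rw [hr]; ring
      _ ≤ volume (Icc r (L - r)) - volume (⋃ i ∈ Finset.range n, Metric.ball (s i) ρ) := by
          rw [Real.volume_Icc]; exact tsub_le_tsub_left h1 _
      _ ≤ volume D := le_measure_sdiff
  have hvol0 : volume D ≠ 0 := fun h => by
    rw [h, nonpos_iff_eq_zero, ENNReal.ofReal_eq_zero] at hvol; linarith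
  have hvolt : volume D ≠ ∞ :=
    ((measure_mono hDI).trans_lt measure_Icc_lt_top).ne
  have hcont : ∀ i, AEMeasurable (fun t => (edist (Φ t) (Φ (s i)))⁻¹) (volume.restrict D) := by
    intro i
    refine ContinuousOn.aemeasurable ?_ hDm
    have h1 : ContinuousOn (fun t => edist (Φ t) (Φ (s i))) D :=
      continuous_edist.comp_continuousOn ((hC.continuousOn.mono hDI).prodMk continuousOn_const)
    exact (continuous_inv (G := ℝ≥0∞)).comp_continuousOn h1
  set B := C₀ * L + (1 - ε)⁻¹ * (2 * Real.log (L / ρ)) with hB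
  have hint : ∀ i ∈ Finset.range n,
      ∫⁻ t in D, (edist (Φ t) (Φ (s i)))⁻¹ ≤ ENNReal.ofReal B := by
    intro i hi
    have hball : ∀ t ∈ D, t ∉ Metric.ball (s i) ρ := fun t ht hti =>
      ht.2 (mem_biUnion hi hti)
    calc ∫⁻ t in D, (edist (Φ t) (Φ (s i)))⁻¹
        ≤ ∫⁻ t in D, (ENNReal.ofReal C₀ +
            ENNReal.ofReal (1 - ε)⁻¹ * ENNReal.ofReal |t - s i|⁻¹) := by
          refine setLIntegral_mono' hDm fun t ht => ?_
          rw [← ENNReal.ofReal_mul (by positivity), ← ENNReal.ofReal_add hC₀ (by positivity)]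
          refine hker t ht.1 (s i) (hs i) fun h => hball t ht ?_
          rw [h]; exact Metric.mem_ball_self hρ0
      _ ≤ ∫⁻ t in Icc 0 L \ Metric.ball (s i) ρ, (ENNReal.ofReal C₀ +
            ENNReal.ofReal (1 - ε)⁻¹ * ENNReal.ofReal |t - s i|⁻¹) :=
          lintegral_mono_set fun t ht => ⟨hDI ht, hball t ht⟩
      _ = ENNReal.ofReal C₀ * volume (Icc 0 L \ Metric.ball (s i) ρ) +
            ENNReal.ofReal (1 - ε)⁻¹ *
              ∫⁻ t in Icc 0 L \ Metric.ball (s i) ρ, ENNReal.ofReal |t - s i|⁻¹ := by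
          rw [lintegral_add_left measurable_const, setLIntegral_const,
            lintegral_const_mul _ (by fun_prop)]
      _ ≤ ENNReal.ofReal C₀ * ENNReal.ofReal L +
            ENNReal.ofReal (1 - ε)⁻¹ * ENNReal.ofReal (2 * Real.log (L / ρ)) := by
          gcongr
          · exact (measure_mono sdiff_subset).trans (by simp)
          · exact setLIntegral_inv_abs_sub_le hρ0 hρL (hs i)
      _ = ENNReal.ofReal B := by
          rw [← ENNReal.ofReal_mul hC₀, ← ENNReal.ofReal_mul (by positivity),
            ← ENNReal.ofReal_add (by positivity) (by positivity)]
  obtain ⟨t, ht, hle⟩ := exists_le_setLAverage hvol0 hvolt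
    (Finset.aemeasurable_fun_sum (Finset.range n) fun i _ => hcont i)
  refine ⟨t, hDI ht, hle.trans ?_⟩
  rw [setLAverage_eq, lintegral_finsetSum' _ fun i _ => hcont i]
  calc _ ≤ (n * ENNReal.ofReal B) / ENNReal.ofReal (L - ε) := by
        refine ENNReal.div_le_div ?_ hvol
        refine (Finset.sum_le_sum hint).trans (by simp)
    _ = ENNReal.ofReal (n * B / (L - ε)) := by
        rw [ENNReal.ofReal_div_of_pos hεL', ENNReal.ofReal_mul hn0.le, ENNReal.ofReal_natCast]
    _ = _ := by
        congr 1
        have : L / ρ = n * (L / r) := by rw [hρ]; field_simp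
        rw [hB, this, Real.log_mul hn0.ne' (by positivity)]
        field_simp
        ring

variable {Γ : Set E} {a : ℕ → E} {s : ℕ → ℝ}

theorem rieszKernel_one {X : Type*} [EDist X] (x y : X) : rieszKernel 1 x y = (edist x y)⁻¹ := by
  rw [rieszKernel, ENNReal.rpow_neg_one]

/-- Each greedy potential is at most that of the point from `exists_potential_le`; then `log n ≤ log
N` and `2 ∑ n ≤ N²`. -/
theorem discreteEnergy_greedy_le (ha : IsGreedySequence (rieszKernel 1) Γ a)
    (himg : Φ '' Icc 0 L = Γ) (hs : ∀ i, s i ∈ Icc 0 L) (has : ∀ i, Φ (s i) = a i)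
    (hu : HasUnitSpeedOn Φ (Icc 0 L)) (hC : ContDiffOn ℝ 1 Φ (Icc 0 L))
    (hinj : ∀ t ∈ Ioo 0 L, ∀ s ∈ Icc 0 L, Φ s = Φ t → s = t)
    {ε : ℝ} (hε : 0 < ε) (hε1 : ε < 1) (hεL : ε < L) :
    ∃ C, ∀ N : ℕ, discreteEnergy (rieszKernel 1) a N ≤
      ENNReal.ofReal ((2 / ((1 - ε) * (L - ε)) * Real.log N + C) * (N : ℝ) ^ 2) := by
  obtain ⟨C, hC0, H⟩ := exists_potential_le hu hC hinj hε hε1 hεL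
  refine ⟨C, fun N => ?_⟩
  have hA : 0 ≤ 2 / ((1 - ε) * (L - ε)) :=
    div_nonneg zero_le_two (mul_nonneg (by linarith) (by linarith))
  set M := 2 / ((1 - ε) * (L - ε)) * Real.log N + C with hM
  have hM0 : 0 ≤ M := add_nonneg (mul_nonneg hA (Real.log_natCast_nonneg N)) hC0
  have hpot : ∀ n ∈ Finset.range N, ∑ j ∈ Finset.range n, rieszKernel 1 (a n) (a j) ≤
      ENNReal.ofReal (n * M) := by
    intro n hn
    obtain rfl | hn1 := Nat.eq_zero_or_pos n
    · simp
    obtain ⟨t, ht, hle⟩ := H n hn1 s hs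
    rw [ha.2 n hn1]
    refine (biInf_le _ (himg ▸ mem_image_of_mem Φ ht)).trans ?_
    simp only [rieszKernel_one, ← has]
    refine hle.trans (ENNReal.ofReal_le_ofReal ?_)
    have : Real.log n ≤ Real.log N := Real.log_le_log (by exact_mod_cast hn1)
      (by exact_mod_cast (Finset.mem_range.1 hn).le)
    rw [hM]
    gcongr
  have hsum : 2 * ∑ n ∈ Finset.range N, (n : ℝ) ≤ (N : ℝ) ^ 2 := by
    have h := Finset.sum_range_id_mul_two N
    have h' : ((∑ i ∈ Finset.range N, i) * 2 : ℕ) ≤ N ^ 2 := by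
      rw [h, sq]; exact Nat.mul_le_mul_left _ (Nat.sub_le _ _)
    have h'' : (((∑ i ∈ Finset.range N, i) * 2 : ℕ) : ℝ) ≤ ((N ^ 2 : ℕ) : ℝ) := by
      exact_mod_cast h'
    push_cast at h''
    linarith
  rw [discreteEnergy, sum_range_erase_eq_two_mul fun i j => by
    rw [rieszKernel_one, rieszKernel_one, edist_comm]]
  calc _ ≤ 2 * ∑ n ∈ Finset.range N, ENNReal.ofReal (n * M) := by
        gcongr with n hn; exact hpot n hn
    _ = ENNReal.ofReal (2 * ∑ n ∈ Finset.range N, n * M) := by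
        rw [ENNReal.ofReal_mul zero_le_two, ENNReal.ofReal_ofNat,
          ENNReal.ofReal_sum_of_nonneg fun n _ => mul_nonneg n.cast_nonneg hM0]
    _ ≤ _ := by
        refine ENNReal.ofReal_le_ofReal ?_
        rw [← Finset.sum_mul, ← mul_assoc, mul_comm M]
        gcongr

end Potential

/-! ### Lower energy bound on arcs and proportions of points -/

theorem energy_subset_ge {X : Type*} [PseudoEMetricSpace X] {Φ : ℝ → X} {L : ℝ} {a : ℕ → X}
    {s : ℕ → ℝ} (hu : HasUnitSpeedOn Φ (Icc 0 L)) (hs : ∀ i, s i ∈ Icc 0 L)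
    (has : ∀ i, Φ (s i) = a i) {S : Finset ℕ} {b ℓ : ℝ} (hℓ : 0 < ℓ)
    (hS : ∀ i ∈ S, s i ∈ Icc b (b + ℓ)) :
    ENNReal.ofReal (2 * (((S.card : ℝ) ^ 2 * Real.log S.card - 2 * (S.card : ℝ) ^ 2) / ℓ)) ≤
      ∑ i ∈ S, ∑ j ∈ S.erase i, rieszKernel 1 (a i) (a j) := by
  refine (energy_interval_ge hℓ hS).trans ?_
  refine Finset.sum_le_sum fun i _ => Finset.sum_le_sum fun j _ => ?_
  rw [rieszKernel_one, ← has, ← has]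
  exact ENNReal.inv_le_inv.2 (hu.edist_le (hs i) (hs j))

theorem discreteEnergy_ge_add {X : Type*} (k : X → X → ℝ≥0∞) (a : ℕ → X) {N : ℕ} {S T : Finset ℕ}
    (hST : Disjoint S T) (hN : S ∪ T = Finset.range N) :
    ∑ i ∈ S, ∑ j ∈ S.erase i, k (a i) (a j) + ∑ i ∈ T, ∑ j ∈ T.erase i, k (a i) (a j) ≤
      discreteEnergy k a N := by
  rw [discreteEnergy, ← hN, Finset.sum_union hST]
  gcongr <;> simp

/-- By `log y ≤ y - 1`, `m² log (N / m) ≤ mN ≤ N²`: replacing `log m` by `log N` costs only a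
lower-order term, however small `m` is. -/
theorem natCast_sq_mul_log_ge {m N : ℕ} (h : m ≤ N) :
    (m : ℝ) ^ 2 * Real.log N - (N : ℝ) ^ 2 ≤ (m : ℝ) ^ 2 * Real.log m := by
  obtain rfl | hm := Nat.eq_zero_or_pos m
  · simp
  have hm0 : (0 : ℝ) < m := by exact_mod_cast hm
  have hmN : (m : ℝ) ≤ N := by exact_mod_cast h
  have hN0 : (0 : ℝ) < N := hm0.trans_le hmN
  have h1 := Real.log_le_sub_one_of_pos (div_pos hN0 hm0)
  rw [Real.log_div hN0.ne' hm0.ne'] at h1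
  have h2 : (m : ℝ) ^ 2 * (Real.log N - Real.log m) ≤ (m : ℝ) ^ 2 * (N / m - 1) := by gcongr
  have h3 : (m : ℝ) ^ 2 * (N / m - 1) = m * N - m ^ 2 := by field_simp
  nlinarith

theorem tendsto_const_div_log_natCast (K : ℝ) :
    Tendsto (fun N : ℕ => K / Real.log N) atTop (𝓝 0) :=
  tendsto_const_nhds.div_atTop (Real.tendsto_log_atTop.comp tendsto_natCast_atTop_atTop)

/-- If the energy has the minimal order of growth, the proportion of points in the initial arc of
length `c` tends to `c / L`. -/
theorem tendsto_proportion_of_energy {e : ℕ → ℝ} {m : ℕ → ℕ} {L c : ℝ} (hc : 0 < c) (hcL : c < L)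
    (hm : ∀ N, m N ≤ N)
    (he : Tendsto (fun N : ℕ => e N / ((N : ℝ) ^ 2 * Real.log N)) atTop (𝓝 (2 / L)))
    (hlow : ∀ N,
      2 * (((m N : ℝ) ^ 2 * Real.log (m N) - 2 * (m N : ℝ) ^ 2) / c) +
        2 * ((((N - m N : ℕ) : ℝ) ^ 2 * Real.log (N - m N : ℕ) - 2 * ((N - m N : ℕ) : ℝ) ^ 2) /
          (L - c)) ≤ e N) :
    Tendsto (fun N : ℕ => (m N : ℝ) / N) atTop (𝓝 (c / L)) := by
  have hL : 0 < L := hc.trans hcL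
  have hLc : 0 < L - c := sub_pos.2 hcL
  -- `2 (x²/c + (1-x)²/(L-c)) - 2/L = κ (x - c/L)²`.
  set κ := 2 * L / (c * (L - c)) with hκ
  have hκ0 : 0 < κ := by positivity
  have hbound : ∀ᶠ N : ℕ in atTop, ((m N : ℝ) / N - c / L) ^ 2 ≤
      (e N / ((N : ℝ) ^ 2 * Real.log N) - 2 / L + (6 / c + 6 / (L - c)) / Real.log N) / κ := by
    filter_upwards [eventually_ge_atTop 2] with N hN
    have hN0 : (0 : ℝ) < N := by exact_mod_cast (by omega : 0 < N)
    have hlog : 0 < Real.log N := Real.log_pos (by exact_mod_cast hN)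
    have hmN : (m N : ℝ) ≤ N := by exact_mod_cast hm N
    have h1 := natCast_sq_mul_log_ge (hm N)
    have h2 := natCast_sq_mul_log_ge (Nat.sub_le N (m N))
    have h := hlow N
    rw [Nat.cast_sub (hm N)] at h h2
    have hm0 : (0 : ℝ) ≤ m N := Nat.cast_nonneg _
    -- The `3` is `2` from the energy bound plus `1` from changing the logarithm.
    have h3 : 2 * (((m N : ℝ) ^ 2 * Real.log N - 3 * (N : ℝ) ^ 2) / c) ≤
        2 * (((m N : ℝ) ^ 2 * Real.log (m N) - 2 * (m N : ℝ) ^ 2) / c) := by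
      gcongr 2 * (?_ / c); nlinarith
    have h4 : 2 * ((((N : ℝ) - m N) ^ 2 * Real.log N - 3 * (N : ℝ) ^ 2) / (L - c)) ≤
        2 * ((((N : ℝ) - m N) ^ 2 * Real.log ((N : ℝ) - m N) - 2 * ((N : ℝ) - m N) ^ 2) /
          (L - c)) := by
      gcongr 2 * (?_ / (L - c)); nlinarith
    rw [le_div_iff₀ hκ0]
    have h5 : ((m N : ℝ) / N - c / L) ^ 2 * κ =
        (2 * (((m N : ℝ) ^ 2 * Real.log N - 3 * (N : ℝ) ^ 2) / c) +
          2 * ((((N : ℝ) - m N) ^ 2 * Real.log N - 3 * (N : ℝ) ^ 2) / (L - c))) /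
            ((N : ℝ) ^ 2 * Real.log N) - 2 / L + (6 / c + 6 / (L - c)) / Real.log N := by
      rw [hκ]; field_simp; ring
    rw [h5]
    gcongr
    linarith
  have hlim : Tendsto (fun N : ℕ => (e N / ((N : ℝ) ^ 2 * Real.log N) - 2 / L +
      (6 / c + 6 / (L - c)) / Real.log N) / κ) atTop (𝓝 0) := by
    have := ((he.sub_const (2 / L)).add
      (tendsto_const_div_log_natCast (6 / c + 6 / (L - c)))).div_const κ
    simpa using this
  have hsq := squeeze_zero' (Eventually.of_forall fun N => sq_nonneg _) hbound hlim
  have habs : Tendsto (fun N : ℕ => |(m N : ℝ) / N - c / L|) atTop (𝓝 0) := by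
    have := hsq.sqrt
    simpa [Real.sqrt_sq_eq_abs] using this
  exact tendsto_sub_nhds_zero_iff.1 ((tendsto_zero_iff_abs_tendsto_zero _).2 habs)

/-! ### Counting measures and equidistribution on `[0, L]` -/

theorem countingProb_real {X : Type*} [MeasurableSpace X] (s : ℕ → X) (N : ℕ) {B : Set X}
    [DecidablePred (· ∈ B)] (hB : MeasurableSet B) :
    (countingProb s N).real B = ((Finset.range N).filter (s · ∈ B)).card / N := by
  have : (countingProb s N) B = (N : ℝ≥0∞)⁻¹ * ((Finset.range N).filter (s · ∈ B)).card := by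
    simp only [countingProb, Measure.smul_apply, Measure.coe_finsetSum, Finset.sum_apply,
      Measure.dirac_apply' _ hB, smul_eq_mul, Finset.card_filter, Nat.cast_sum, indicator_apply]
    simp
  rw [Measure.real, this, ENNReal.toReal_mul, ENNReal.toReal_inv]
  simp [div_eq_inv_mul]

theorem integral_countingProb {X : Type*} [MeasurableSpace X] [MeasurableSingletonClass X]
    (s : ℕ → X) (N : ℕ) (f : X → ℝ) :
    ∫ x, f x ∂(countingProb s N) = (N : ℝ)⁻¹ * ∑ i ∈ Finset.range N, f (s i) := by
  rw [countingProb, integral_smul_measure, integral_finsetSum_measure]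
  · simp
  · intro i _
    exact integrable_dirac (by simp)

theorem isProbabilityMeasure_countingProb {X : Type*} [MeasurableSpace X] (s : ℕ → X) {N : ℕ}
    (hN : N ≠ 0) : IsProbabilityMeasure (countingProb s N) :=
  ⟨by
    simp only [countingProb, Measure.smul_apply, Measure.coe_finsetSum, Finset.sum_apply,
      measure_univ, smul_eq_mul]
    simp [ENNReal.inv_mul_cancel, hN]⟩

theorem restrict_countingProb {X : Type*} [MeasurableSpace X] [MeasurableSingletonClass X]
    {s : ℕ → X} {A : Set X} (hs : ∀ i, s i ∈ A) (N : ℕ) :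
    (countingProb s N).restrict A = countingProb s N := by
  refine Measure.restrict_eq_self_of_ae_mem ?_
  rw [ae_iff]
  change countingProb s N Aᶜ = 0
  simp [countingProb, hs]

/-- A sequence in `[0, L]` whose empirical distribution functions converge to the uniform one is
equidistributed. -/
theorem tendsto_mean_of_tendsto_proportion {s : ℕ → ℝ} {L : ℝ} (hL : 0 < L)
    (hs : ∀ i, s i ∈ Icc 0 L)
    (h : ∀ c ∈ Ioo 0 L, Tendsto
      (fun N : ℕ => (((Finset.range N).filter (s · ≤ c)).card : ℝ) / N) atTop (𝓝 (c / L)))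
    {g : ℝ → ℝ} (hg : ContinuousOn g (Icc 0 L)) :
    Tendsto (fun N : ℕ => (N : ℝ)⁻¹ * ∑ i ∈ Finset.range N, g (s i)) atTop
      (𝓝 (L⁻¹ * ∫ t in Icc 0 L, g t)) := by
  have hν : IsProbabilityMeasure ((ENNReal.ofReal L)⁻¹ • volume.restrict (Icc 0 L)) :=
    ⟨by simp [ENNReal.inv_mul_cancel, hL]⟩
  let ν : ProbabilityMeasure ℝ := ⟨(ENNReal.ofReal L)⁻¹ • volume.restrict (Icc 0 L), hν⟩
  -- The shift to `N + 1` avoids the empty counting measure, which is not a probability.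
  let μ : ℕ → ProbabilityMeasure ℝ := fun N =>
    ⟨countingProb s (N + 1), isProbabilityMeasure_countingProb s N.succ_ne_zero⟩
  have hνr : ∀ B, MeasurableSet B → (ν : Measure ℝ).real B = volume.real (B ∩ Icc 0 L) / L := by
    intro B hB
    simp [ν, Measure.real, Measure.restrict_apply hB, ENNReal.toReal_inv, hL.le, div_eq_inv_mul]
  have hIic : ∀ c, Tendsto (fun N => (μ N : Measure ℝ).real (Iic c)) atTop
      (𝓝 ((ν : Measure ℝ).real (Iic c))) := by
    intro c
    suffices Tendsto (fun N : ℕ => (((Finset.range N).filter (s · ≤ c)).card : ℝ) / N) atTop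
        (𝓝 ((ν : Measure ℝ).real (Iic c))) by
      have h2 := (tendsto_add_atTop_iff_nat 1).2 this
      refine h2.congr fun N => ?_
      exact (countingProb_real s (N + 1) measurableSet_Iic).symm
    rw [hνr _ measurableSet_Iic]
    rcases le_or_gt L c with hcL | hcL
    · have e1 : Iic c ∩ Icc 0 L = Icc 0 L :=
        inter_eq_self_of_subset_right fun t ht => ht.2.trans hcL
      rw [e1, Real.volume_real_Icc_of_le hL.le, sub_zero, div_self hL.ne']
      refine tendsto_const_nhds.congr' ?_
      filter_upwards [eventually_ge_atTop 1] with N hN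
      rw [Finset.filter_true_of_mem fun i _ => (hs i).2.trans hcL, Finset.card_range,
        div_self (by positivity)]
    rcases lt_or_ge 0 c with hc0 | hc0
    · have e1 : Iic c ∩ Icc 0 L = Icc 0 c := by
        ext t; simp only [mem_inter_iff, mem_Iic, mem_Icc]
        exact ⟨fun ht => ⟨ht.2.1, ht.1⟩, fun ht => ⟨ht.2, ht.1, ht.2.trans hcL.le⟩⟩
      rw [e1, Real.volume_real_Icc_of_le hc0.le, sub_zero]
      exact h c ⟨hc0, hcL⟩
    · have e1 : volume.real (Iic c ∩ Icc 0 L) = 0 := by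
        have : Iic c ∩ Icc 0 L ⊆ {0} := fun t ht => le_antisymm (ht.1.trans hc0) ht.2.1
        rw [Measure.real, measure_mono_null this (by simp), ENNReal.toReal_zero]
      rw [e1, zero_div]
      refine tendsto_order.2 ⟨fun x hx => Eventually.of_forall fun N => hx.trans_le (by positivity),
        fun x hx => ?_⟩
      -- For `c ≤ 0` the count is dominated by that of `[0, c']`, whose limiting proportion `c' / L`
      -- is below `x`.
      set c' := min (L / 2) (x * L / 2) with hc'
      have hc'0 : 0 < c' := by positivity
      have hc'L : c' < L := (min_le_left _ _).trans_lt (by linarith)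
      have hlt : c' / L < x := by
        rw [div_lt_iff₀ hL]
        exact (min_le_right _ _).trans_lt (by nlinarith [mul_pos hx hL])
      filter_upwards [(tendsto_order.1 (h c' ⟨hc'0, hc'L⟩)).2 x hlt] with N hN
      refine lt_of_le_of_lt ?_ hN
      gcongr with i hi
      exact hc0.trans hc'0.le
  have hconv : Tendsto μ atTop (𝓝 ν) := by
    refine (isPiSystem_Ioc (id : ℝ → ℝ) id).tendsto_probabilityMeasure_of_tendsto_of_mem ?_ ?_ ?_
    · rintro _ ⟨a, b, -, rfl⟩; exact measurableSet_Ioc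
    · intro u hu x hx
      obtain ⟨a, b, hab, hsub⟩ := mem_nhds_iff_exists_Ioo_subset.1 (hu.mem_nhds hx)
      obtain ⟨b', hb'⟩ := exists_between hab.2
      exact ⟨Ioc a b', ⟨a, b', hab.1.trans hb'.1, rfl⟩, Ioc_mem_nhds hab.1 hb'.1,
        fun t ht => hsub ⟨ht.1, ht.2.trans_lt hb'.2⟩⟩
    · rintro _ ⟨a, b, hab, rfl⟩
      have hd : ∀ κ : ProbabilityMeasure ℝ, (κ : Measure ℝ).real (Ioc a b) =
          (κ : Measure ℝ).real (Iic b) - (κ : Measure ℝ).real (Iic a) := fun κ => by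
        rw [← Iic_sdiff_Iic, measureReal_sdiff (Iic_subset_Iic.2 (show a ≤ b from le_of_lt hab)) measurableSet_Iic]
      have : Tendsto (fun N => (μ N : Measure ℝ).real (Ioc a b)) atTop
          (𝓝 ((ν : Measure ℝ).real (Ioc a b))) := by
        simp only [hd]; exact (hIic b).sub (hIic a)
      simpa using this
  -- Extension of `g` to the line, constant on each side of `[0, L]`.
  let G : BoundedContinuousFunction ℝ ℝ :=
    (BoundedContinuousFunction.mkOfCompact ⟨(Icc 0 L).domRestrict g, hg.domRestrict⟩).compContinuous
      ⟨projIcc 0 L hL.le, continuous_projIcc⟩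
  have hG : ∀ t ∈ Icc 0 L, G t = g t := fun t ht => by
    simp only [G, BoundedContinuousFunction.compContinuous_apply, ContinuousMap.coe_mk,
      projIcc_of_mem hL.le ht]
    rfl
  have hint := ProbabilityMeasure.tendsto_iff_forall_integral_tendsto.1 hconv G
  have e1 : ∫ t, G t ∂(ν : Measure ℝ) = L⁻¹ * ∫ t in Icc 0 L, g t := by
    change ∫ t, G t ∂((ENNReal.ofReal L)⁻¹ • volume.restrict (Icc 0 L)) = _
    rw [integral_smul_measure, setIntegral_congr_fun measurableSet_Icc hG]
    simp [ENNReal.toReal_inv, hL.le]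
  rw [e1] at hint
  refine (tendsto_add_atTop_iff_nat 1).1 (hint.congr fun N => ?_)
  refine (integral_countingProb s (N + 1) G).trans ?_
  simp only [hG _ (hs _)]

/-! ### Smooth arcs and closed curves -/

section

variable {p : ℕ} {Γ : Set (EuclideanSpace ℝ (Fin p))} {L : ℝ} {Φ : ℝ → EuclideanSpace ℝ (Fin p)}

theorem IsSmoothNaturalParam.lipschitzOnWith (h : IsSmoothNaturalParam Γ L Φ) :
    LipschitzOnWith 1 Φ (Icc 0 L) := fun s hs t ht => by
  simpa using h.unitSpeed.edist_le hs ht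

theorem IsSmoothNaturalParam.isCompact (h : IsSmoothNaturalParam Γ L Φ) : IsCompact Γ :=
  h.image_eq ▸ isCompact_Icc.image_of_continuousOn h.contDiffOn.continuousOn

/-- Arclength measure on the curve is the image of Lebesgue measure under the natural
parametrization. -/
theorem IsSmoothNaturalParam.hausdorffMeasure_restrict (h : IsSmoothNaturalParam Γ L Φ) :
    (μH[1] : Measure (EuclideanSpace ℝ (Fin p))).restrict Γ =
      (volume.restrict (Icc 0 L)).map Φ := by
  have hΦ : AEMeasurable Φ (volume.restrict (Icc 0 L)) :=
    h.contDiffOn.continuousOn.aemeasurable measurableSet_Icc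
  have hfin : IsFiniteMeasure ((volume.restrict (Icc 0 L)).map Φ) := inferInstance
  have hle : (μH[1] : Measure (EuclideanSpace ℝ (Fin p))).restrict Γ ≤
      (volume.restrict (Icc 0 L)).map Φ := by
    refine Measure.le_iff.2 fun B hB => ?_
    rw [Measure.restrict_apply hB, Measure.map_apply_of_aemeasurable hΦ hB,
      Measure.restrict_apply₀' measurableSet_Icc.nullMeasurableSet]
    have e : B ∩ Γ = Φ '' (Φ ⁻¹' B ∩ Icc 0 L) := by
      rw [image_preimage_inter, h.image_eq]
    rw [e]
    calc _ ≤ ((1 : NNReal) : ℝ≥0∞) ^ (1 : ℝ) * μH[1] (Φ ⁻¹' B ∩ Icc 0 L) :=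
          (h.lipschitzOnWith.mono inter_subset_right).hausdorffMeasure_image_le zero_le_one
      _ = _ := by rw [hausdorffMeasure_real]; simp
  have hfin' : IsFiniteMeasure ((μH[1] : Measure (EuclideanSpace ℝ (Fin p))).restrict Γ) :=
    ⟨(hle univ).trans_lt (measure_lt_top _ _)⟩
  -- The Lipschitz bound gives one inequality between the measures; both have total mass `L`, so
  -- they coincide.
  refine Measure.eq_of_le_of_measure_univ_eq hle ?_
  rw [Measure.restrict_apply_univ, h.length_eq, Measure.map_apply_of_aemeasurable hΦ .univ]
  simp

theorem IsSmoothNaturalParam.integral_arclength (h : IsSmoothNaturalParam Γ L Φ)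
    {f : EuclideanSpace ℝ (Fin p) → ℝ} (hf : ContinuousOn f Γ) :
    ∫ x in Γ, f x ∂((μH[1] Γ)⁻¹ • (μH[1] : Measure (EuclideanSpace ℝ (Fin p))).restrict Γ) =
      L⁻¹ * ∫ t in Icc 0 L, f (Φ t) := by
  have hm : MeasurableSet Γ := h.isCompact.isClosed.measurableSet
  have hΦ : AEMeasurable Φ (volume.restrict (Icc 0 L)) :=
    h.contDiffOn.continuousOn.aemeasurable measurableSet_Icc
  have hfm := hf.aestronglyMeasurable (μ := μH[1]) hm
  rw [Measure.restrict_smul, Measure.restrict_restrict hm, inter_self, integral_smul_measure,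
    h.hausdorffMeasure_restrict, integral_map hΦ (h.hausdorffMeasure_restrict ▸ hfm), h.length_eq]
  simp [ENNReal.toReal_inv, h.length_pos.le]

/-- This weak injectivity treats arcs and closed curves together: only the two end parameters may
share a point. -/
theorem exists_smoothNaturalParam (h : IsSmoothJordanArc Γ ∨ IsSmoothClosedJordanCurve Γ) :
    ∃ L Φ, IsSmoothNaturalParam Γ L Φ ∧
      ∀ t ∈ Ioo 0 L, ∀ s ∈ Icc 0 L, Φ s = Φ t → s = t := by
  rcases h with ⟨-, L, Φ, h, hinj⟩ | ⟨-, L, Φ, h, h0, hinj⟩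
  · exact ⟨L, Φ, h, fun t ht s hs hst => hinj hs (Ioo_subset_Icc_self ht) hst⟩
  · refine ⟨L, Φ, h, fun t ht s hs hst => ?_⟩
    rcases hs.2.lt_or_eq with hsL | rfl
    · exact hinj ⟨hs.1, hsL⟩ (Ioo_subset_Ico_self ht) hst
    · rw [← h0] at hst
      exact absurd (hinj ⟨le_rfl, h.length_pos⟩ (Ioo_subset_Ico_self ht) hst) ht.1.ne

variable {a : ℕ → EuclideanSpace ℝ (Fin p)}

theorem IsSmoothNaturalParam.discreteEnergy_ne_top (h : IsSmoothNaturalParam Γ L Φ)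
    (hinj : ∀ t ∈ Ioo 0 L, ∀ s ∈ Icc 0 L, Φ s = Φ t → s = t)
    (ha : IsGreedySequence (rieszKernel 1) Γ a) {s : ℕ → ℝ} (hs : ∀ i, s i ∈ Icc 0 L)
    (has : ∀ i, Φ (s i) = a i) (N : ℕ) : discreteEnergy (rieszKernel 1) a N ≠ ∞ := by
  have hL := h.length_pos
  obtain ⟨C, hC⟩ := discreteEnergy_greedy_le ha h.image_eq hs has h.unitSpeed h.contDiffOn hinj
    (ε := min (1 / 2) (L / 2)) (by positivity)
    ((min_le_left _ _).trans_lt (by norm_num)) ((min_le_right _ _).trans_lt (by linarith))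
  exact ne_top_of_le_ne_top ENNReal.ofReal_ne_top (hC N)

theorem IsSmoothNaturalParam.tendsto_energy (h : IsSmoothNaturalParam Γ L Φ)
    (hinj : ∀ t ∈ Ioo 0 L, ∀ s ∈ Icc 0 L, Φ s = Φ t → s = t)
    (ha : IsGreedySequence (rieszKernel 1) Γ a) {s : ℕ → ℝ} (hs : ∀ i, s i ∈ Icc 0 L)
    (has : ∀ i, Φ (s i) = a i) :
    Tendsto (fun N : ℕ => (discreteEnergy (rieszKernel 1) a N).toReal /
      ((N : ℝ) ^ 2 * Real.log N)) atTop (𝓝 (2 / L)) := by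
  have hL := h.length_pos
  refine tendsto_order.2 ⟨fun x hx => ?_, fun x hx => ?_⟩
  · have hlim : Tendsto (fun N : ℕ => 2 / L - 4 / L / Real.log N) atTop (𝓝 (2 / L)) := by
      simpa using tendsto_const_nhds.sub (tendsto_const_div_log_natCast (4 / L))
    filter_upwards [(tendsto_order.1 hlim).1 x hx, eventually_ge_atTop 2] with N hN hN2
    refine hN.trans_le ?_
    have hN0 : (0 : ℝ) < N := by exact_mod_cast (by omega : 0 < N)
    have hlog : 0 < Real.log N := Real.log_pos (by exact_mod_cast hN2)
    have hlow := energy_subset_ge h.unitSpeed hs has (S := Finset.range N) (b := 0) hL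
      (fun i _ => by rw [zero_add]; exact hs i)
    have hlow' := (ENNReal.ofReal_le_iff_le_toReal
      (h.discreteEnergy_ne_top hinj ha hs has N)).1 hlow
    rw [Finset.card_range] at hlow'
    rw [le_div_iff₀ (by positivity)]
    refine le_trans (le_of_eq ?_) hlow'
    field_simp
    ring
  -- `ε` is fixed before `N`, since `C` depends on it.
  · have hA : Tendsto (fun ε : ℝ => 2 / ((1 - ε) * (L - ε))) (𝓝[>] 0) (𝓝 (2 / L)) := by
      have : ContinuousAt (fun ε : ℝ => 2 / ((1 - ε) * (L - ε))) 0 := by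
        refine ContinuousAt.div (by fun_prop) (by fun_prop) (by simp [hL.ne'])
      have h2 := this.tendsto.mono_left (nhdsWithin_le_nhds (s := Ioi 0))
      simpa using h2
    obtain ⟨ε, hεx, hε, hε1⟩ := ((tendsto_order.1 hA).2 x hx |>.and
      (Ioo_mem_nhdsGT (show (0 : ℝ) < min 1 L by positivity))).exists
    obtain ⟨C, hC⟩ := discreteEnergy_greedy_le ha h.image_eq hs has h.unitSpeed h.contDiffOn hinj
      hε (hε1.trans_le (min_le_left _ _)) (hε1.trans_le (min_le_right _ _))
    have hlim : Tendsto (fun N : ℕ => 2 / ((1 - ε) * (L - ε)) + max C 0 / Real.log N) atTop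
        (𝓝 (2 / ((1 - ε) * (L - ε)))) := by
      simpa using tendsto_const_nhds.add (tendsto_const_div_log_natCast (max C 0))
    filter_upwards [(tendsto_order.1 hlim).2 x hεx, eventually_ge_atTop 2] with N hN hN2
    refine lt_of_le_of_lt ?_ hN
    have hN0 : (0 : ℝ) < N := by exact_mod_cast (by omega : 0 < N)
    have hlog : 0 < Real.log N := Real.log_pos (by exact_mod_cast hN2)
    have h1 : 0 < 1 - ε := sub_pos.2 (hε1.trans_le (min_le_left _ _))
    have h2 : 0 < L - ε := sub_pos.2 (hε1.trans_le (min_le_right _ _))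
    have hup : (discreteEnergy (rieszKernel 1) a N).toReal ≤
        (2 / ((1 - ε) * (L - ε)) * Real.log N + max C 0) * (N : ℝ) ^ 2 := by
      refine ENNReal.toReal_le_of_le_ofReal (by positivity) ((hC N).trans ?_)
      gcongr
      exact le_max_left _ _
    rw [div_le_iff₀ (by positivity)]
    refine hup.trans (le_of_eq ?_)
    field_simp

theorem IsSmoothNaturalParam.tendsto_proportion (h : IsSmoothNaturalParam Γ L Φ)
    (hinj : ∀ t ∈ Ioo 0 L, ∀ s ∈ Icc 0 L, Φ s = Φ t → s = t)
    (ha : IsGreedySequence (rieszKernel 1) Γ a) {s : ℕ → ℝ} (hs : ∀ i, s i ∈ Icc 0 L)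
    (has : ∀ i, Φ (s i) = a i) {c : ℝ} (hc : c ∈ Ioo 0 L) :
    Tendsto (fun N : ℕ => (((Finset.range N).filter (s · ≤ c)).card : ℝ) / N) atTop
      (𝓝 (c / L)) := by
  have hm : ∀ N, ((Finset.range N).filter (s · ≤ c)).card ≤ N := fun N =>
    (Finset.card_filter_le _ _).trans (Finset.card_range N).le
  refine tendsto_proportion_of_energy hc.1 hc.2 hm (h.tendsto_energy hinj ha hs has) fun N => ?_
  set S := (Finset.range N).filter (s · ≤ c) with hS
  set T := (Finset.range N).filter (¬ s · ≤ c) with hT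
  have hcard : T.card = N - S.card := by
    have : S.card + T.card = (Finset.range N).card :=
      Finset.card_filter_add_card_filter_not (s · ≤ c)
    rw [Finset.card_range] at this
    omega
  have hST := discreteEnergy_ge_add (rieszKernel 1) a
    (Finset.disjoint_filter_filter_not (Finset.range N) (Finset.range N) (s · ≤ c))
    (Finset.filter_union_filter_not_eq (s · ≤ c) (Finset.range N))
  have h1 := energy_subset_ge h.unitSpeed hs has (S := S) (b := 0) hc.1 fun i hi => by
    rw [zero_add]; exact ⟨(hs i).1, (Finset.mem_filter.1 hi).2⟩
  have h2 := energy_subset_ge h.unitSpeed hs has (S := T) (b := c) (sub_pos.2 hc.2) fun i hi => by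
    rw [add_sub_cancel]; exact ⟨(not_le.1 (Finset.mem_filter.1 hi).2).le, (hs i).2⟩
  rw [hcard] at h2
  have hfin := h.discreteEnergy_ne_top hinj ha hs has N
  refine (ENNReal.ofReal_le_iff_le_toReal hfin).1 ?_
  exact ENNReal.ofReal_add_le.trans ((add_le_add h1 h2).trans hST)

end

theorem theorem2p7 (p : ℕ) (Γ : Set (EuclideanSpace ℝ (Fin p)))
    (hΓ : IsSmoothJordanArc Γ ∨ IsSmoothClosedJordanCurve Γ)
    (a : ℕ → EuclideanSpace ℝ (Fin p))
    (ha : IsGreedySequence (rieszKernel 1) Γ a) :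
    Tendsto (fun N : ℕ => discreteEnergy (rieszKernel 1) a N /
        ENNReal.ofReal ((N : ℝ) ^ 2 * Real.log N)) atTop (𝓝 (2 / μH[1] Γ)) ∧
      WeakStarTendsto Γ (countingProb a) ((μH[1] Γ)⁻¹ • μH[1].restrict Γ) := by
  obtain ⟨L, Φ, h, hinj⟩ := exists_smoothNaturalParam hΓ
  have hL := h.length_pos
  have hex : ∀ i, ∃ t ∈ Icc 0 L, Φ t = a i := fun i => by
    have := ha.1 i
    rwa [← h.image_eq] at this
  -- If `Φ 0 = Φ L`, either end parameter may be chosen for that point.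
  choose s hs has using hex
  constructor
  · have hlim := ENNReal.tendsto_ofReal (h.tendsto_energy hinj ha hs has)
    rw [ENNReal.ofReal_div_of_pos hL, ENNReal.ofReal_ofNat, ← h.length_eq] at hlim
    refine hlim.congr' ?_
    filter_upwards [eventually_ge_atTop 2] with N hN
    have hN0 : (0 : ℝ) < N := by exact_mod_cast (by omega : 0 < N)
    have hlog : 0 < Real.log N := Real.log_pos (by exact_mod_cast hN)
    rw [ENNReal.ofReal_div_of_pos (by positivity),
      ENNReal.ofReal_toReal (h.discreteEnergy_ne_top hinj ha hs has N)]
  · intro f hf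
    rw [h.integral_arclength hf]
    have hfΦ : ContinuousOn (fun t => f (Φ t)) (Icc 0 L) :=
      hf.comp h.contDiffOn.continuousOn fun t ht => h.image_eq ▸ mem_image_of_mem Φ ht
    refine (tendsto_mean_of_tendsto_proportion hL hs
      (fun c hc => h.tendsto_proportion hinj ha hs has hc) hfΦ).congr fun N => ?_
    rw [restrict_countingProb ha.1, integral_countingProb]
    simp only [has]
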